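/- Let $\mathsf G=(\mathsf V,\mathsf E)$ be a finite connected graph, loops and multiple edges being allowed, where each edge of $\mathsf E$ comes with its two orientations $e$ and $e^{-1}$. Let $\mathsf E^+\subset\mathsf E$ be an orientation, that is, a set containing exactly one element of each pair $\{e,e^{-1}\}$. Let $\mathbb K=\mathbb R$ or $\mathbb C$. Let $C_1(\mathsf G,\mathbb Z)$ be the free $\mathbb Z$-module over $\mathsf E$ modulo the relations $e+e^{-1}=0$, let $\partial e=\overline e-\underline e$ (end minus start) be the boundary map to $C_0(\mathsf G,\mathbb Z)=\mathbb Z^{(\mathsf V)}$, let $C^i=\mathrm{Hom}(C_i,\mathbb Z)$, and let $\delta:C^0\to C^1$ be the adjoint of $\partial$. Let $e^\star\in C^1(\mathsf G,\mathbb Z)$ be the cochain with $e^\star(e)=1$, $e^\star(e^{-1})=-1$, zero on all other edges. Put $\Omega_1(\mathsf G)=C_1(\mathsf G,\mathbb Z)\otimes\mathbb K$ and $\Omega^1(\mathsf G)=C^1(\mathsf G,\mathbb Z)\otimes\mathbb K$. The pairing between $k$-th exterior powers is $(\theta_1\wedge\dots\wedge\theta_k,\gamma_1\wedge\dots\wedge\gamma_k)=\det(\theta_i(\gamma_j))$.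 For a spanning subgraph $S$ (identified with its set of edges), write $\underline x^S=\prod_{e\in \mathsf E^+\cap S}x_e$. For $k\ge 0$, let $\mathcal F_{k+1}(\mathsf G)$ be the set of spanning forests of $\mathsf G$ with $k+1$ connected components, and let $\mathcal C_k(\mathsf G)$ be the set of connected spanning subgraphs $K$ such that the group of cycles $Z_1(K,\mathbb Z)=\ker \partial\cap C_1(K,\mathbb Z)$ has rank $k$. For $F\in\mathcal F_{k+1}(\mathsf G)$ let $b_F$ be the exterior product of the elements of an integral basis of $B^1(\mathsf G_{/F},\mathbb Z)=\{\delta f: f \text{ constant on each component of } F\}$, and for $K\in\mathcal C_k(\mathsf G)$ let $z_K$ be the exterior product of the elements of an integral basis of $Z_1(K,\mathbb Z)$; both are defined up to a sign. For $\varphi\in\Omega_1(\mathsf G)^{\wedge k}$ and $\vartheta\in\Omega^1(\mathsf G)^{\wedge k}$, define polynomials in the variables $\underline x=(x_e)_{e\in\mathsf E^+}$ by $$\mathsf A^{(k)}_{\mathsf G}(\varphi,\underline x)=\sum_{F\in\mathcal F_{k+1}(\mathsf G)}|(\varphi,b_F)|^2\,\underline x^F,\qquad \mathsf C^{(k)}_{\mathsf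 G}(\vartheta,\underline x)=\sum_{K\in\mathcal C_k(\mathsf G)}|(\vartheta,z_K)|^2\,\underline x^K .$$ Suppose that $\mathsf G$ is embedded in an oriented sphere, the embedding being given by its rotation system: the cyclic counterclockwise order of the oriented edges issued from each vertex, with faces the orbits of the face permutation (a single face if $\mathsf G$ has no edge), and $|\mathsf V|-|\mathsf E^+|+|\text{faces}|=2$. Let $\mathsf G^\dagger$ be the dual graph, whose vertices are the faces of $\mathsf G$; the oriented edge $e^\dagger$ dual to $e\in\mathsf E$ goes from the face on the right of $e$ to the face on the left of $e$, and $(e^\dagger)^{-1}=(e^{-1})^\dagger$. The edges of $\mathsf G^\dagger$ are oriented by $\{e^\dagger:e\in\mathsf E^+\}$, and $x_{e^\dagger}=x_e$. Let $\varphi\mapsto\varphi^\sharp$ be the map $\Omega_1(\mathsf G)^{\wedge k}\to\Omega^1(\mathsf G^\dagger)^{\wedge k}$ induced by $e\mapsto e^\sharp=(e^\dagger)^\star$. Then, for every $k\ge 0$: 1. the map $F\mapsto (F^c)^\dagger$ is a bijection from $\mathcal F_{k+1}(\mathsf G)$ onto $\mathcal C_k(\mathsf G^\dagger)$; 2. for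 every $\varphi\in\Omega_1(\mathsf G)^{\wedge k}$, in the field of rational functions $\mathbb R(x_e:e\in\mathsf E^+)$, $$\mathsf A^{(k)}_{\mathsf G}(\varphi,\underline x)=\underline x^{\mathsf E^+}\,\mathsf C^{(k)}_{\mathsf G^\dagger}(\varphi^\sharp,\underline x^{-1}).$$ -/

import Mathlib

open scoped TensorProduct

noncomputable section

/-- A graph with vertex set `V` and set of oriented edges `E`: every edge comes with both
orientations, exchanged by the fixed-point free involution `inv`.
Loops and multiple edges are allowed. -/
structure OrientedGraph (V E : Type*) where
  src : E → V
  tgt : E → V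
  inv : E → E
  inv_inv : ∀ e, inv (inv e) = e
  inv_ne : ∀ e, inv e ≠ e
  src_inv : ∀ e, src (inv e) = tgt e

namespace OrientedGraph

/-! ### Subgraphs and orientations -/

section Subgraphs

variable {V E : Type*} (G : OrientedGraph V E)

/-- `P` is an orientation: it contains exactly one element of each pair `{e, e⁻¹}`. -/
def IsOrientation (P : Finset E) : Prop :=
  ∀ e, e ∈ P ↔ G.inv e ∉ P

/-- The edge set of a spanning subgraph: a set of oriented edges that contains, with each edge,
the opposite edge. Spanning subgraphs are identified with their edge sets. -/
def IsSpanningSubgraph (S : Finset E) : Prop :=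
  ∀ e ∈ S, G.inv e ∈ S

/-- The set of connected components of the spanning subgraph with edge set `S`: the quotient of `V`
by the equivalence relation generated by `src e ∼ tgt e`, for `e` in `S`. -/
def Components (S : Finset E) : Type _ :=
  Quot fun v w : V => ∃ e ∈ S, G.src e = v ∧ G.tgt e = w

/-- The number of connected components of a spanning subgraph. -/
def numComponents (S : Finset E) : ℕ :=
  Nat.card (G.Components S)

/-- A graph is connected if it has exactly one connected component
(in particular it has a vertex). -/
def Connected [Fintype E] : Prop :=
  G.numComponents Finset.univ = 1

end Subgraphs

/-! ### Integral chains and cochains, cycles and cuts -/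

section Chains

variable {V E : Type*} (G : OrientedGraph V E)

/-- `0`-chains: the free `ℤ`-module over the vertices. -/
abbrev Chain0 (_ : OrientedGraph V E) : Type _ :=
  V →₀ ℤ

/-- `1`-chains: the free `ℤ`-module over the oriented edges modulo the relations `e + e⁻¹ = 0`. -/
abbrev Chain1 : Type _ :=
  (E →₀ ℤ) ⧸ Submodule.span ℤ
    (Set.range fun e : E => (Finsupp.single e 1 + Finsupp.single (G.inv e) 1 : E →₀ ℤ))

/-- `0`-cochains. -/
abbrev Cochain0 : Type _ :=
  Module.Dual ℤ G.Chain0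

/-- `1`-cochains. -/
abbrev Cochain1 : Type _ :=
  Module.Dual ℤ G.Chain1

/-- The class of an oriented edge in the group of `1`-chains. -/
def edge (e : E) : G.Chain1 :=
  Submodule.Quotient.mk (Finsupp.single e 1)

/-- The linear map on `1`-chains determined by a function on oriented edges
that is antisymmetric. -/
def liftChain {M : Type*} [AddCommGroup M] (f : E → M) (hf : ∀ e, f (G.inv e) = -f e) :
    G.Chain1 →ₗ[ℤ] M :=
  Submodule.liftQ _ (Finsupp.linearCombination ℤ f) <| by
    rw [Submodule.span_le]
    rintro _ ⟨e, rfl⟩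
    simp [hf]

theorem liftChain_edge {M : Type*} [AddCommGroup M] (f : E → M) (hf : ∀ e, f (G.inv e) = -f e)
    (e : E) : G.liftChain f hf (G.edge e) = f e := by
  simp [liftChain, edge]

theorem tgt_inv (e : E) : G.tgt (G.inv e) = G.src e := by
  rw [← G.src_inv, G.inv_inv]

/-- The boundary operator, `∂ e = tgt e - src e`. -/
def boundary : G.Chain1 →ₗ[ℤ] G.Chain0 :=
  G.liftChain (fun e => Finsupp.single (G.tgt e) 1 - Finsupp.single (G.src e) 1) fun e => by
    rw [G.src_inv, G.tgt_inv, neg_sub]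

/-- The coboundary operator, the adjoint of the boundary operator. -/
def coboundary : G.Cochain0 →ₗ[ℤ] G.Cochain1 :=
  G.boundary.dualMap

open Classical in
/-- The cochain `e⋆`, with `e⋆(e) = 1`, `e⋆(e⁻¹) = -1`, that vanishes on all other edges. -/
def star (e : E) : G.Cochain1 :=
  G.liftChain (fun e' => (if e' = e then 1 else 0) - (if e' = G.inv e then 1 else 0)) fun e' => by
    have h₁ : G.inv e' = e ↔ e' = G.inv e :=
      ⟨fun h => by rw [← h, G.inv_inv], fun h => by rw [h, G.inv_inv]⟩
    have h₂ : G.inv e' = G.inv e ↔ e' = e :=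
      ⟨fun h => by rw [← G.inv_inv e', h, G.inv_inv], fun h => by rw [h]⟩
    simp only [h₁, h₂, neg_sub]

theorem star_inv (e : E) : G.star (G.inv e) = -G.star e := by
  ext e'
  simp [star, liftChain]
  rw [G.inv_inv]

/-- The submodule `C₁(S, ℤ)` of chains supported by a spanning subgraph `S`. -/
def chainsOn (S : Finset E) : Submodule ℤ G.Chain1 :=
  Submodule.span ℤ (G.edge '' S)

/-- The group of cycles `Z₁(S, ℤ)` of a spanning subgraph `S`. -/
def cycles (S : Finset E) : Submodule ℤ G.Chain1 :=
  G.chainsOn S ⊓ LinearMap.ker G.boundary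

/-- The `0`-cochains that are constant on each connected component of the spanning
subgraph `S`, that is, `C⁰(G/S, ℤ)`. -/
def constantOn (S : Finset E) : Submodule ℤ G.Cochain0 where
  carrier := {f | ∀ e ∈ S, f (Finsupp.single (G.src e) 1) = f (Finsupp.single (G.tgt e) 1)}
  add_mem' hf hg e he := by simp only [LinearMap.add_apply, hf e he, hg e he]
  zero_mem' _ _ := rfl
  smul_mem' c f hf e he := by simp only [LinearMap.smul_apply, hf e he]

/-- The group of cuts `B¹(G/S, ℤ)` of the graph obtained from `G` by contracting
the edges of `S`, seen as a subgroup of `C¹(G, ℤ)`. -/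
def cuts (S : Finset E) : Submodule ℤ G.Cochain1 :=
  (G.constantOn S).map G.coboundary

end Chains

/-! ### Forests and connected spanning subgraphs -/

section Families

variable {V E : Type*} [Fintype E] (G : OrientedGraph V E)

open Classical in
/-- `ℱ_k(G)`: the spanning forests (spanning subgraphs without non-zero cycle)
with `k` connected components. -/
def forests (k : ℕ) : Finset (Finset E) :=
  Finset.univ.filter fun S =>
    G.IsSpanningSubgraph S ∧ G.cycles S = ⊥ ∧ G.numComponents S = k

open Classical in
/-- `𝒞_k(G)`: the connected spanning subgraphs with first Betti number `k`. -/
def connectedSubgraphs (k : ℕ) : Finset (Finset E) :=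
  Finset.univ.filter fun S =>
    G.IsSpanningSubgraph S ∧ G.numComponents S = 1 ∧ Module.finrank ℤ (G.cycles S) = k

end Families

/-! ### Weights and generating polynomials -/

section Weights

variable (𝕜 : Type*) [RCLike 𝕜] {V E : Type*} (G : OrientedGraph V E)

/-- `Ω₁(G) = C₁(G, ℤ) ⊗ 𝕜`. -/
abbrev KChain1 : Type _ :=
  𝕜 ⊗[ℤ] G.Chain1

/-- `Ω¹(G) = C¹(G, ℤ) ⊗ 𝕜`. -/
abbrev Form1 : Type _ :=
  𝕜 ⊗[ℤ] G.Cochain1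

variable {𝕜}

/-- The canonical map from `1`-forms to linear forms on `Ω₁(G)`. -/
def formToDual : G.Form1 𝕜 →ₗ[𝕜] Module.Dual 𝕜 (G.KChain1 𝕜) :=
  LinearMap.liftBaseChange 𝕜 (Module.Dual.baseChange 𝕜)

/-- The pairing of `k`-th exterior powers, characterised on decomposable elements by
`(θ₁ ∧ ⋯ ∧ θ_k, φ₁ ∧ ⋯ ∧ φ_k) = det (θ_i (φ_j))`. -/
def pairing (k : ℕ) (ϑ : ⋀[𝕜]^k (G.Form1 𝕜)) (φ : ⋀[𝕜]^k (G.KChain1 𝕜)) : 𝕜 :=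
  exteriorPower.pairingDual 𝕜 (G.KChain1 𝕜) k (exteriorPower.map k G.formToDual ϑ) φ

/-- The exterior product `m₁ ∧ ⋯ ∧ m_k`, after extension of scalars to `𝕜`, of elements of
a `ℤ`-module. -/
def wedge (𝕜 : Type*) [RCLike 𝕜] {M : Type*} [AddCommGroup M] {k : ℕ} (m : Fin k → M) :
    ⋀[𝕜]^k (𝕜 ⊗[ℤ] M) :=
  exteriorPower.ιMulti 𝕜 k fun i => (1 : 𝕜) ⊗ₜ[ℤ] m i

/-- Replacing an integral basis by another one multiplies the exterior product of its elements
by a sign. -/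
theorem wedge_basis_eq_or_eq_neg {M : Type*} [AddCommGroup M] {N : Submodule ℤ M} {k : ℕ}
    (b b' : Module.Basis (Fin k) ℤ N) :
    wedge 𝕜 (fun i => (b i : M)) = wedge 𝕜 (fun i => (b' i : M)) ∨
      wedge 𝕜 (fun i => (b i : M)) = -wedge 𝕜 (fun i => (b' i : M)) := by
  have upd (m : Fin k → N) (i : Fin k) (z : N) :
      (fun j => (1 : 𝕜) ⊗ₜ[ℤ] (Function.update m i z j : M)) =
        Function.update (fun j => (1 : 𝕜) ⊗ₜ[ℤ] (m j : M)) i (1 ⊗ₜ[ℤ] (z : M)) :=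
    funext fun j => Function.apply_update (fun _ (x : N) => (1 : 𝕜) ⊗ₜ[ℤ] (x : M)) m i z j
  let f : N [⋀^Fin k]→ₗ[ℤ] ⋀[𝕜]^k (𝕜 ⊗[ℤ] M) :=
    { toFun := fun m => wedge 𝕜 fun i => (m i : M)
      map_update_add' := by
        intro inst m i x y
        obtain rfl : inst = instDecidableEqFin k := Subsingleton.elim _ _
        simp only [wedge, upd, Submodule.coe_add, TensorProduct.tmul_add,
          AlternatingMap.map_update_add]
      map_update_smul' := by
        intro inst m i c x
        obtain rfl : inst = instDecidableEqFin k := Subsingleton.elim _ _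
        have hc : (1 : 𝕜) ⊗ₜ[ℤ] ((c • x : N) : M) = (c : 𝕜) • ((1 : 𝕜) ⊗ₜ[ℤ] (x : M)) := by
          rw [Submodule.coe_smul, TensorProduct.tmul_smul, Int.cast_smul_eq_zsmul]
        simp only [wedge, upd, hc, AlternatingMap.map_update_smul]
        exact Int.cast_smul_eq_zsmul 𝕜 c _
      map_eq_zero_of_eq' := by
        intro m i j h hij
        exact (exteriorPower.ιMulti 𝕜 k).map_eq_zero_of_eq _ (by simp only [h]) hij }
  have hf : f = (LinearMap.toSpanSingleton ℤ _ (f b')).compAlternatingMap b'.det := by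
    refine Module.Basis.ext_alternating b' fun v hv => ?_
    have hv' : (fun i => b' (v i)) = b' ∘ Equiv.ofBijective v (Finite.injective_iff_bijective.1 hv) :=
      rfl
    rw [hv', AlternatingMap.map_perm, AlternatingMap.map_perm]
    simp [Module.Basis.det_self]
  have h : f b = b'.det b • f b' := by
    conv_lhs => rw [hf]
    simp
  have hu : IsUnit (b'.det b) := Module.Basis.isUnit_det b' b
  rcases Int.isUnit_iff.1 hu with h' | h'
  · left
    rw [h', one_smul] at h
    exact h
  · right
    rw [h', neg_smul, one_smul] at h
    exact h

open Classical in
/-- The weight `|(ϑ, z_S)|²`, where `z_S` is the exterior product of the elements of an integral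
basis of the group of cycles `Z₁(S, ℤ)`; it does not depend on the basis.
(It is set to be `0` if the rank of `Z₁(S, ℤ)` is not `k`.) -/
def cycleWeight (k : ℕ) (ϑ : ⋀[𝕜]^k (G.Form1 𝕜)) (S : Finset E) : ℝ :=
  if h : Nonempty (Module.Basis (Fin k) ℤ (G.cycles S)) then
    ‖G.pairing k ϑ (wedge 𝕜 fun i => (h.some i : G.Chain1))‖ ^ 2
  else 0

theorem cycleWeight_eq (k : ℕ) (ϑ : ⋀[𝕜]^k (G.Form1 𝕜)) (S : Finset E)
    (b : Module.Basis (Fin k) ℤ (G.cycles S)) :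
    G.cycleWeight k ϑ S = ‖G.pairing k ϑ (wedge 𝕜 fun i => (b i : G.Chain1))‖ ^ 2 := by
  have h : Nonempty (Module.Basis (Fin k) ℤ (G.cycles S)) := ⟨b⟩
  rw [cycleWeight, dif_pos h]
  rcases wedge_basis_eq_or_eq_neg (𝕜 := 𝕜) h.some b with h' | h' <;> rw [h']
  simp [pairing]

open Classical in
/-- The weight `|(φ, b_S)|²`, where `b_S` is the exterior product of the elements of an integral
basis of the group of cuts `B¹(G/S, ℤ)`; it does not depend on the basis.
(It is set to be `0` if the rank of `B¹(G/S, ℤ)` is not `k`.) -/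
def cutWeight (k : ℕ) (φ : ⋀[𝕜]^k (G.KChain1 𝕜)) (S : Finset E) : ℝ :=
  if h : Nonempty (Module.Basis (Fin k) ℤ (G.cuts S)) then
    ‖G.pairing k (wedge 𝕜 fun i => (h.some i : G.Cochain1)) φ‖ ^ 2
  else 0

theorem cutWeight_eq (k : ℕ) (φ : ⋀[𝕜]^k (G.KChain1 𝕜)) (S : Finset E)
    (b : Module.Basis (Fin k) ℤ (G.cuts S)) :
    G.cutWeight k φ S = ‖G.pairing k (wedge 𝕜 fun i => (b i : G.Cochain1)) φ‖ ^ 2 := by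
  have h : Nonempty (Module.Basis (Fin k) ℤ (G.cuts S)) := ⟨b⟩
  rw [cutWeight, dif_pos h]
  rcases wedge_basis_eq_or_eq_neg (𝕜 := 𝕜) h.some b with h' | h' <;> rw [h']
  simp [pairing]

open Classical in
/-- The monomial `x^S`, the product of the variables `x_e` over the edges `e` of `S` that belong
to the orientation `P`. -/
def monomial (P S : Finset E) : MvPolynomial {e // e ∈ P} ℝ :=
  ∏ e ∈ Finset.univ.filter (fun e : {e // e ∈ P} => e.1 ∈ S), MvPolynomial.X e

/-- The polynomial `A^{(k)}_G(φ, x)`, in the variables `x_e` for `e` in the orientation `P`. -/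
def forestPoly [Fintype E] (P : Finset E) (k : ℕ) (φ : ⋀[𝕜]^k (G.KChain1 𝕜)) :
    MvPolynomial {e // e ∈ P} ℝ :=
  ∑ F ∈ G.forests (k + 1), G.cutWeight k φ F • monomial P F

/-- The polynomial `C^{(k)}_G(ϑ, x)`, in the variables `x_e` for `e` in the orientation `P`. -/
def connectedPoly [Fintype E] (P : Finset E) (k : ℕ) (ϑ : ⋀[𝕜]^k (G.Form1 𝕜)) :
    MvPolynomial {e // e ∈ P} ℝ :=
  ∑ K ∈ G.connectedSubgraphs k, G.cycleWeight k ϑ K • monomial P K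

end Weights

/-! ### Graphs embedded in an oriented sphere and dual graphs -/

/-- A cellular embedding of a graph in an oriented closed surface, given by its rotation system:
the permutation `rot` sends an oriented edge to the next one, in the counterclockwise order, among
the oriented edges with the same starting vertex, which it permutes cyclically. -/
structure RotationSystem {V E : Type*} (G : OrientedGraph V E) where
  rot : Equiv.Perm E
  sameCycle_iff : ∀ e e', rot.SameCycle e e' ↔ G.src e = G.src e'

namespace RotationSystem

variable {V E : Type*} {G : OrientedGraph V E} (R : G.RotationSystem)

/-- Sends an oriented edge `e` to the next edge along the boundary of the face on the left of `e`:
the edge that comes just before `e⁻¹` in the counterclockwise order around the end of `e`. -/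
def facePerm : Equiv.Perm E :=
  (Function.Involutive.toPerm G.inv G.inv_inv).trans R.rot.symm

/-- The faces of the embedding. A face is encoded by the set of oriented edges that have
it on their left, which is an orbit of `facePerm`. If the graph has no edge, there is
a single face, with empty boundary. -/
def Face : Type _ :=
  {s : Set E // (∃ e, s = {e' | R.facePerm.SameCycle e e'}) ∨ (IsEmpty E ∧ s = ∅)}

/-- The face on the left of an oriented edge. -/
def left (e : E) : R.Face :=
  ⟨{e' | R.facePerm.SameCycle e e'}, Or.inl ⟨e, rfl⟩⟩

/-- The face on the right of an oriented edge. -/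
def right (e : E) : R.Face :=
  R.left (G.inv e)

/-- The surface in which the connected graph is embedded is a sphere: its Euler characteristic
`|V| - |E| / 2 + |F|` (recall that each geometric edge appears twice in `E`) is `2`. -/
def IsSpherical : Prop :=
  (Nat.card V : ℤ) - Nat.card E / 2 + Nat.card R.Face = 2

/-- The dual graph: its vertices are the faces of `G`, and the oriented edge `e†` dual to `e`
(with the same label) crosses `e` from the face on its right to the face on its left. -/
def dual : OrientedGraph R.Face E where
  src := R.right
  tgt := R.left
  inv := G.inv
  inv_inv := G.inv_inv
  inv_ne := G.inv_ne
  src_inv e := by rw [right, G.inv_inv]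

/-- The map `♯ : C₁(G, ℤ) → C¹(G†, ℤ)`, `e ↦ (e†)⋆`. -/
def sharp : G.Chain1 →ₗ[ℤ] R.dual.Cochain1 :=
  G.liftChain (fun e => R.dual.star e) fun e => R.dual.star_inv e

/-- The `k`-th exterior power `φ ↦ φ^♯` of the map `♯ : Ω₁(G) → Ω¹(G†)`. -/
def sharpPow (𝕜 : Type*) [RCLike 𝕜] (k : ℕ) : ⋀[𝕜]^k (G.KChain1 𝕜) →ₗ[𝕜] ⋀[𝕜]^k (R.dual.Form1 𝕜) :=
  exteriorPower.map k (R.sharp.baseChange 𝕜)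

end RotationSystem

end OrientedGraph

end

noncomputable section

namespace OrientedGraph

/-! ### Chains in coordinates -/

section ChainCoordinates

variable {V E : Type*} (G : OrientedGraph V E)

/-! The linear map `e† ↦ e⋆` from chains of `G†` to cochains of `G` is injective and is the
transpose of `♯`. On the sphere it carries the cycles of `G†` onto the cuts of `G`
(`map_cycles_dual_univ`). Every cut comes from a dual cycle, because the increments of a potential
around a face add up to zero. By Euler's formula both groups have the same rank, and the cuts of a
connected graph are saturated, so the inclusion is an equality.

Requiring a cochain to vanish on `S` is requiring the dual chain to be supported by `Sᶜ`; hence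
`Z₁(Sᶜ) ≃ B¹(G/S)` for every spanning subgraph `S` (`map_cycles_dual_compl`). Comparing ranks gives
the bijection between forests and connected subgraphs. Transporting an integral basis through this
isomorphism shows that the weights agree (`cycleWeight_sharpPow`), and the monomials match one
variable at a time. -/

theorem edge_inv (e : E) : G.edge (G.inv e) = -G.edge e := by
  rw [eq_neg_iff_add_eq_zero, add_comm]
  exact (Submodule.Quotient.mk_eq_zero _).2 (Submodule.subset_span ⟨e, rfl⟩)

variable {G} in
theorem chain_hom_ext {M : Type*} [AddCommGroup M] {f g : G.Chain1 →ₗ[ℤ] M}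
    (h : ∀ e, f (G.edge e) = g (G.edge e)) : f = g :=
  Submodule.linearMap_qext _ (Finsupp.lhom_ext' fun e => LinearMap.ext_ring (h e))

theorem inv_eq_iff (e f : E) : G.inv e = f ↔ e = G.inv f :=
  ⟨fun h => by rw [← h, G.inv_inv], fun h => by rw [h, G.inv_inv]⟩

theorem star_edge [DecidableEq E] (e f : E) :
    G.star e (G.edge f) = (if f = e then 1 else 0) - (if f = G.inv e then 1 else 0) := by
  rw [star, liftChain_edge]
  congr

theorem star_edge_comm (e f : E) : G.star e (G.edge f) = G.star f (G.edge e) := by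
  classical
  rw [star_edge, star_edge]
  simp only [eq_comm (a := e), G.inv_eq_iff]

variable {G} {P : Finset E}

theorem IsOrientation.star_edge [DecidableEq E] (hP : G.IsOrientation P) {e f : E} (he : e ∈ P)
    (hf : f ∈ P) : G.star e (G.edge f) = if f = e then 1 else 0 := by
  have : f ≠ G.inv e := fun h => (hP e).1 he (h ▸ hf)
  rw [G.star_edge, if_neg this, sub_zero]

/-- The edges of `P` and their stars are dual to each other; an edge outside `P` is minus an edge of
`P`. Chains thus have coordinates, which yield torsion-freeness, supports and ranks below. -/
theorem IsOrientation.sum_star_smul_edge (hP : G.IsOrientation P) (x : G.Chain1) :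
    ∑ e ∈ P, G.star e x • G.edge e = x := by
  classical
  have key : ∀ f ∈ P, ∑ e ∈ P, G.star e (G.edge f) • G.edge e = G.edge f := fun f hf => by
    rw [Finset.sum_congr rfl fun e he => by rw [hP.star_edge he hf]]
    simp [hf]
  have : ∑ e ∈ P, (LinearMap.toSpanSingleton ℤ G.Chain1 (G.edge e)).comp (G.star e) =
      LinearMap.id := by
    refine chain_hom_ext fun f => ?_
    simp only [LinearMap.sum_apply, LinearMap.comp_apply, LinearMap.toSpanSingleton_apply,
      LinearMap.id_apply]
    by_cases hf : f ∈ P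
    · exact key f hf
    · have h := key (G.inv f) (by by_contra h; exact hf ((hP f).2 h))
      simpa only [edge_inv, map_neg, neg_smul, Finset.sum_neg_distrib, neg_inj] using h
  simpa using LinearMap.congr_fun this x

theorem IsOrientation.isTorsionFree (hP : G.IsOrientation P) :
    Module.IsTorsionFree ℤ G.Chain1 :=
  .of_smul_eq_zero fun n x h => or_iff_not_imp_left.2 fun hn => by
    rw [← hP.sum_star_smul_edge x]
    refine Finset.sum_eq_zero fun e _ => ?_
    have h' := congrArg (G.star e) h
    rw [map_smul, map_zero, smul_eq_mul, mul_eq_zero, or_iff_right hn] at h'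
    rw [h', zero_smul]

theorem IsOrientation.mem_chainsOn_iff (hP : G.IsOrientation P) {S : Finset E}
    (hS : G.IsSpanningSubgraph S) {x : G.Chain1} :
    x ∈ G.chainsOn S ↔ ∀ e ∉ S, G.star e x = 0 := by
  classical
  constructor
  · intro hx e he
    induction hx using Submodule.span_induction with
    | mem y hy =>
      obtain ⟨f, hf, rfl⟩ := hy
      have h₁ : f ≠ e := fun h => he (h ▸ hf)
      have h₂ : f ≠ G.inv e := fun h => he (by rw [← G.inv_inv e, ← h]; exact hS f hf)
      rw [G.star_edge, if_neg h₁, if_neg h₂, sub_zero]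
    | zero => exact map_zero _
    | add y z _ _ hy hz => rw [map_add, hy, hz, add_zero]
    | smul c y _ hy => rw [map_smul, hy, smul_zero]
  · intro h
    rw [← hP.sum_star_smul_edge x]
    refine Submodule.sum_mem _ fun e _ => ?_
    by_cases he : e ∈ S
    · exact Submodule.smul_mem _ _ (Submodule.subset_span ⟨e, he, rfl⟩)
    · rw [h e he, zero_smul]
      exact Submodule.zero_mem _

theorem IsOrientation.linearIndepOn_edge (hP : G.IsOrientation P) :
    LinearIndepOn ℤ G.edge (P : Set E) := by
  classical
  rw [linearIndepOn_finset_iff]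
  intro g hg f hf
  have h := congrArg (G.star f) hg
  rw [map_sum, map_zero, Finset.sum_congr rfl fun e he => by
    rw [map_smul, hP.star_edge hf he]] at h
  simpa [hf] using h

theorem IsOrientation.chainsOn_inter [DecidableEq E] (hP : G.IsOrientation P) {S : Finset E}
    (hS : G.IsSpanningSubgraph S) : G.chainsOn (P ∩ S) = G.chainsOn S := by
  refine le_antisymm (Submodule.span_mono (Set.image_mono (by simp))) (Submodule.span_le.2 ?_)
  rintro _ ⟨e, he, rfl⟩
  by_cases h : e ∈ P
  · exact Submodule.subset_span ⟨e, by simpa using ⟨h, he⟩, rfl⟩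
  · have h' : G.inv e ∈ P := by by_contra h'; exact h ((hP e).2 h')
    rw [← G.inv_inv e, edge_inv]
    exact Submodule.neg_mem _ (Submodule.subset_span ⟨G.inv e, by simpa using ⟨h', hS e he⟩, rfl⟩)

theorem IsOrientation.finrank_chainsOn [DecidableEq E] (hP : G.IsOrientation P) {S : Finset E}
    (hS : G.IsSpanningSubgraph S) : Module.finrank ℤ (G.chainsOn S) = (P ∩ S).card := by
  have h : LinearIndepOn ℤ G.edge ((P ∩ S : Finset E) : Set E) :=
    hP.linearIndepOn_edge.mono (by simp)
  have h' := finrank_span_eq_card h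
  rw [← hP.chainsOn_inter hS, chainsOn, Set.image_eq_range]
  exact h'.trans (Fintype.card_coe _)

variable (G) in
/-- The orientation reversal, as a permutation of the oriented edges. -/
def invPerm : Equiv.Perm E :=
  Function.Involutive.toPerm G.inv G.inv_inv

theorem IsOrientation.compl_eq_map [Fintype E] [DecidableEq E] (hP : G.IsOrientation P) :
    Pᶜ = P.map G.invPerm.toEmbedding := by
  ext e
  rw [Finset.mem_compl, Finset.mem_map_equiv, hP e, not_not]
  rfl

theorem IsOrientation.sum_univ [Fintype E] {M : Type*} [AddCommMonoid M] (hP : G.IsOrientation P)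
    (f : E → M) : ∑ e, f e = ∑ e ∈ P, (f e + f (G.inv e)) := by
  classical
  rw [← Finset.sum_add_sum_compl P, hP.compl_eq_map, Finset.sum_map, Finset.sum_add_distrib]
  rfl

theorem IsOrientation.card_eq_two_mul [Fintype E] (hP : G.IsOrientation P) :
    Nat.card E = 2 * P.card := by
  have h := hP.sum_univ fun _ => 1
  simp only [Finset.sum_const, smul_eq_mul, mul_one, Finset.card_univ, Nat.reduceAdd] at h
  rw [Nat.card_eq_fintype_card, h, mul_comm]

theorem isSpanningSubgraph_univ [Fintype E] : G.IsSpanningSubgraph Finset.univ :=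
  fun _ _ => Finset.mem_univ _

theorem IsSpanningSubgraph.compl [Fintype E] [DecidableEq E] {S : Finset E}
    (hS : G.IsSpanningSubgraph S) : G.IsSpanningSubgraph Sᶜ := fun e he => by
  rw [Finset.mem_compl] at he ⊢
  exact fun h => he (G.inv_inv e ▸ hS _ h)

theorem boundary_edge (e : E) :
    G.boundary (G.edge e) = Finsupp.single (G.tgt e) 1 - Finsupp.single (G.src e) 1 :=
  G.liftChain_edge _ _ e

end ChainCoordinates

/-! ### Ranks of the groups of cycles and of cuts -/

section Ranks

theorem finrank_range_add_finrank_ker_int {M N : Type*} [AddCommGroup M] [AddCommGroup N]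
    [Module.Finite ℤ M] (f : M →ₗ[ℤ] N) :
    Module.finrank ℤ (LinearMap.range f) + Module.finrank ℤ (LinearMap.ker f) =
      Module.finrank ℤ M := by
  rw [← f.quotKerEquivRange.finrank_eq, Submodule.finrank_quotient_add_finrank]

variable {V E : Type*} (G : OrientedGraph V E)

/-- The connected component of a vertex. -/
def component (S : Finset E) (v : V) : G.Components S :=
  Quot.mk _ v

variable {G}

theorem component_surjective (S : Finset E) : Function.Surjective (G.component S) :=
  Quot.mk_surjective

theorem component_src {S : Finset E} {e : E} (he : e ∈ S) :
    G.component S (G.src e) = G.component S (G.tgt e) :=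
  Quot.sound ⟨e, he, rfl, rfl⟩

/-- A relation that holds between the ends of each edge, and that is an equivalence relation, holds
within components. -/
theorem component_induction {S : Finset E} {r : V → V → Prop} (hr : Equivalence r)
    (h : ∀ e ∈ S, r (G.src e) (G.tgt e)) {v w : V} (hvw : G.component S v = G.component S w) :
    r v w := by
  have := Quot.eqvGen_exact hvw
  refine (Equivalence.eqvGen_iff hr).1 (this.mono ?_)
  rintro _ _ ⟨e, he, rfl, rfl⟩
  exact h e he

instance [Finite V] (S : Finset E) : Finite (G.Components S) :=
  Finite.of_surjective _ (G.component_surjective S)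

/-- Within a component, the difference of two vertices is a boundary. Sliding every vertex to a
chosen representative `r` of its component therefore changes a `0`-chain by a boundary, and the
result is zero as soon as the coefficients sum to zero on each component. -/
theorem map_boundary_chainsOn (S : Finset E) :
    (G.chainsOn S).map G.boundary =
      LinearMap.ker (Finsupp.lmapDomain ℤ ℤ (G.component S)) := by
  apply le_antisymm
  · rw [chainsOn, Submodule.map_span_le]
    rintro _ ⟨e, he, rfl⟩
    rw [LinearMap.mem_ker, boundary_edge, map_sub, Finsupp.lmapDomain_apply,
      Finsupp.lmapDomain_apply, Finsupp.mapDomain_single, Finsupp.mapDomain_single,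
      component_src he, sub_self]
  · intro x hx
    let r := Function.surjInv (G.component_surjective S)
    have hr : Equivalence fun v w : V => (Finsupp.single w 1 - Finsupp.single v 1 : V →₀ ℤ) ∈
        (G.chainsOn S).map G.boundary :=
      ⟨fun v => by rw [sub_self]; exact Submodule.zero_mem _,
        fun h => by rw [← neg_sub]; exact Submodule.neg_mem _ h,
        fun h h' => by rw [← sub_add_sub_cancel]; exact Submodule.add_mem _ h' h⟩
    have hv (v : V) : (Finsupp.single v 1 - Finsupp.single (r (G.component S v)) 1 : V →₀ ℤ) ∈
        (G.chainsOn S).map G.boundary := by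
      refine component_induction (G := G) (S := S) hr (fun e he => ?_)
        (Function.surjInv_eq (G.component_surjective S) _)
      rw [← boundary_edge]
      exact Submodule.mem_map_of_mem (Submodule.subset_span ⟨e, he, rfl⟩)
    have key (y : V →₀ ℤ) : y - Finsupp.mapDomain r (Finsupp.mapDomain (G.component S) y) ∈
        (G.chainsOn S).map G.boundary := by
      induction y using Finsupp.induction_linear with
      | zero => simp
      | add y z hy hz =>
        rw [Finsupp.mapDomain_add, Finsupp.mapDomain_add, add_sub_add_comm]
        exact Submodule.add_mem _ hy hz
      | single v a =>
        have := Submodule.smul_mem _ a (hv v)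
        rw [smul_sub, Finsupp.smul_single_one, Finsupp.smul_single_one] at this
        rwa [Finsupp.mapDomain_single, Finsupp.mapDomain_single]
    have := key x
    rwa [show Finsupp.mapDomain (G.component S) x = 0 from hx, Finsupp.mapDomain_zero,
      sub_zero] at this

theorem finrank_map_boundary_chainsOn [Finite V] (S : Finset E) :
    Module.finrank ℤ ((G.chainsOn S).map G.boundary) + G.numComponents S = Nat.card V := by
  have h := finrank_range_add_finrank_ker_int (Finsupp.lmapDomain ℤ ℤ (G.component S))
  have hs : Function.Surjective (Finsupp.lmapDomain ℤ ℤ (G.component S)) :=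
    Finsupp.mapDomain_surjective (G.component_surjective S)
  have := Fintype.ofFinite V
  have := Fintype.ofFinite (G.Components S)
  rw [LinearMap.range_eq_top.2 hs, finrank_top, Module.finrank_finsupp_self,
    Module.finrank_finsupp_self, ← map_boundary_chainsOn] at h
  rw [numComponents, Nat.card_eq_fintype_card, Nat.card_eq_fintype_card, ← h, add_comm]

/-- Rank-nullity for `∂` restricted to `C₁(S, ℤ)`, written additively to avoid truncated
subtraction. -/
theorem IsOrientation.finrank_cycles [Finite V] [Finite E] [DecidableEq E] {P S : Finset E}
    (hP : G.IsOrientation P) (hS : G.IsSpanningSubgraph S) :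
    Module.finrank ℤ (G.cycles S) + Nat.card V = (P ∩ S).card + G.numComponents S := by
  have h := finrank_range_add_finrank_ker_int (G.boundary.domRestrict (G.chainsOn S))
  have hc : G.cycles S =
      (LinearMap.ker (G.boundary.domRestrict (G.chainsOn S))).map (G.chainsOn S).subtype := by
    rw [LinearMap.ker_domRestrict, Submodule.map_comap_subtype]
    rfl
  rw [LinearMap.range_domRestrict, hP.finrank_chainsOn hS] at h
  rw [hc, ← (Submodule.equivMapOfInjective _ (Submodule.subtype_injective _) _).finrank_eq,
    ← finrank_map_boundary_chainsOn S, ← h]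
  ring

/-- `0`-cochains constant on components are functions on the set of components. -/
def constantOnEquiv (S : Finset E) : G.constantOn S ≃ₗ[ℤ] (G.Components S → ℤ) where
  toFun f := Quot.lift (fun v => f.1 (Finsupp.single v 1)) <| by
    rintro _ _ ⟨e, he, rfl, rfl⟩
    exact f.2 e he
  invFun g := ⟨Finsupp.linearCombination ℤ fun v => g (G.component S v), fun e he => by
    rw [Finsupp.linearCombination_single, Finsupp.linearCombination_single, component_src he]⟩
  map_add' f g := by
    ext ⟨v⟩
    rfl
  map_smul' c f := by
    ext ⟨v⟩
    rfl
  left_inv f := by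
    ext v
    simp [component]
  right_inv g := by
    ext ⟨v⟩
    simp [component]

theorem finrank_constantOn [Finite V] (S : Finset E) :
    Module.finrank ℤ (G.constantOn S) = G.numComponents S := by
  have := Fintype.ofFinite (G.Components S)
  rw [(constantOnEquiv S).finrank_eq, Module.finrank_fintype_fun_eq_card, numComponents,
    Nat.card_eq_fintype_card]

theorem coboundary_apply_edge (f : G.Cochain0) (e : E) :
    G.coboundary f (G.edge e) =
      f (Finsupp.single (G.tgt e) 1) - f (Finsupp.single (G.src e) 1) := by
  rw [coboundary, LinearMap.dualMap_apply, boundary_edge, map_sub]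

theorem ker_coboundary [Fintype E] : LinearMap.ker G.coboundary = G.constantOn Finset.univ := by
  ext f
  constructor
  · intro hf e _
    have := LinearMap.congr_fun (LinearMap.mem_ker.1 hf) (G.edge e)
    rw [coboundary_apply_edge, LinearMap.zero_apply, sub_eq_zero] at this
    exact this.symm
  · intro hf
    refine chain_hom_ext fun e => ?_
    rw [coboundary_apply_edge, hf e (Finset.mem_univ e), sub_self, LinearMap.zero_apply]

/-- This turns the contraction of `S` into a vanishing condition, the form in which it can be
dualised. -/
theorem mem_cuts_iff {S : Finset E} {c : G.Cochain1} :
    c ∈ G.cuts S ↔ c ∈ G.cuts ∅ ∧ ∀ e ∈ S, c (G.edge e) = 0 := by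
  constructor
  · rintro ⟨f, hf, rfl⟩
    refine ⟨⟨f, fun e he => absurd he (Finset.notMem_empty e), rfl⟩, fun e he => ?_⟩
    rw [coboundary_apply_edge, hf e he, sub_self]
  · rintro ⟨⟨f, -, rfl⟩, h⟩
    refine ⟨f, fun e he => ?_, rfl⟩
    have := h e he
    rw [coboundary_apply_edge, sub_eq_zero] at this
    exact this.symm

theorem finrank_cuts [Finite V] [Fintype E] (S : Finset E) :
    Module.finrank ℤ (G.cuts S) + G.numComponents Finset.univ = G.numComponents S := by
  have h := finrank_range_add_finrank_ker_int (G.coboundary.domRestrict (G.constantOn S))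
  have hle : G.constantOn Finset.univ ≤ G.constantOn S := fun f hf e _ => hf e (Finset.mem_univ e)
  rw [LinearMap.range_domRestrict, LinearMap.ker_domRestrict, ker_coboundary,
    (Submodule.comapSubtypeEquivOfLe hle).finrank_eq, finrank_constantOn, finrank_constantOn] at h
  exact h

theorem numComponents_empty : G.numComponents ∅ = Nat.card V := by
  refine Nat.card_congr (Equiv.ofBijective (G.component ∅) ⟨fun v w h => ?_,
    G.component_surjective ∅⟩).symm
  exact component_induction (G := G) (S := ∅) eq_equivalence
    (fun e he => absurd he (Finset.notMem_empty e)) h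

theorem Connected.component_eq [Fintype E] (hG : G.Connected) (v w : V) :
    G.component Finset.univ v = G.component Finset.univ w :=
  have := (Nat.card_eq_one_iff_unique.1 hG).1
  Subsingleton.elim _ _

/-- The group of cuts of a connected graph is saturated. -/
theorem Connected.mem_cuts_of_smul_mem [Fintype E] (hG : G.Connected) {n : ℤ} (hn : n ≠ 0)
    {c : G.Cochain1} (h : n • c ∈ G.cuts ∅) : c ∈ G.cuts ∅ := by
  obtain ⟨f, -, hf⟩ := h
  obtain ⟨q⟩ := (Nat.card_eq_one_iff_unique.1 hG).2
  obtain ⟨v₀, -⟩ := G.component_surjective _ q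
  have he (e : E) : f (Finsupp.single (G.tgt e) 1) - f (Finsupp.single (G.src e) 1) =
      n * c (G.edge e) := by
    rw [← coboundary_apply_edge, hf, LinearMap.smul_apply, smul_eq_mul]
  -- The increments of the potential along edges are multiples of `n`, hence so are all its
  -- differences, by connectedness. Normalising it to vanish at `v₀` makes it divisible by `n`.
  have hdvd (v : V) : n ∣ f (Finsupp.single v 1) - f (Finsupp.single v₀ 1) := by
    have hr : Equivalence fun v w : V => n ∣ f (Finsupp.single w 1) - f (Finsupp.single v 1) :=
      ⟨fun v => by simp, fun h => by rwa [← dvd_neg, neg_sub],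
        fun h h' => by rw [← sub_add_sub_cancel]; exact dvd_add h' h⟩
    exact component_induction hr (fun e _ => he e ▸ dvd_mul_right _ _)
      (hG.component_eq v₀ v)
  choose g hg using hdvd
  refine ⟨Finsupp.linearCombination ℤ g, fun e he => absurd he (Finset.notMem_empty e),
    chain_hom_ext fun e => mul_left_cancel₀ hn ?_⟩
  rw [← he, coboundary_apply_edge]
  simp only [Finsupp.linearCombination_single, one_smul, mul_sub, ← hg]
  ring

end Ranks


namespace RotationSystem

variable {V E : Type*} {G : OrientedGraph V E} (R : G.RotationSystem)

/-! ### Connectedness of the dual graph -/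

instance [Finite E] : Finite R.Face :=
  inferInstanceAs (Finite {_s : Set E // _})

theorem left_eq_left {e e' : E} (h : R.facePerm.SameCycle e e') : R.left e = R.left e' :=
  Subtype.ext <| Set.ext fun _ => ⟨h.symm.trans, h.trans⟩

theorem left_facePerm (e : E) : R.left (R.facePerm e) = R.left e :=
  R.left_eq_left (Equiv.Perm.sameCycle_apply_left.2 (Equiv.Perm.SameCycle.refl _ e))

theorem left_surjective [Nonempty E] : Function.Surjective R.left := by
  rintro ⟨s, ⟨e, rfl⟩ | ⟨h, -⟩⟩
  · exact ⟨e, rfl⟩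
  · exact absurd h (not_isEmpty_iff.2 inferInstance)

theorem src_facePerm (e : E) : G.src (R.facePerm e) = G.tgt e := by
  rw [← G.src_inv]
  exact (R.sameCycle_iff _ _).1
    (Equiv.Perm.sameCycle_symm_apply_left.2 (Equiv.Perm.SameCycle.refl R.rot (G.inv e)))

section Connectedness

variable [Fintype E]

theorem component_left_inv (e : E) :
    R.dual.component Finset.univ (R.left (G.inv e)) = R.dual.component Finset.univ (R.left e) :=
  R.dual.component_src (Finset.mem_univ e)

/-- Turning around a vertex crosses one edge at a time: the face on the right of `rot f` is the face
on the left of `f`. -/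
theorem component_left_of_src_eq {e e' : E} (h : G.src e = G.src e') :
    R.dual.component Finset.univ (R.left e) = R.dual.component Finset.univ (R.left e') := by
  have hrot (f : E) : R.dual.component Finset.univ (R.left (R.rot f)) =
      R.dual.component Finset.univ (R.left f) := by
    have h₁ : R.facePerm (G.inv (R.rot f)) = f := by
      change R.rot.symm (G.inv (G.inv (R.rot f))) = f
      rw [G.inv_inv, Equiv.symm_apply_apply]
    rw [← R.component_left_inv, ← R.left_facePerm, h₁]
  obtain ⟨n, rfl⟩ := ((R.sameCycle_iff e e').2 h).exists_nat_pow_eq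
  clear h
  induction n with
  | zero => rfl
  | succ n ih => rw [pow_succ', Equiv.Perm.mul_apply, hrot, ← ih]

/-- A path of `G` joins the starting points of two given edges. The faces met around one vertex are
linked in the dual, and the two ends of an edge share the faces on its sides. -/
theorem dual_connected (hG : G.Connected) : R.dual.Connected := by
  refine Nat.card_eq_one_iff_unique.2 ?_
  rcases isEmpty_or_nonempty E with hE | hE
  · have h₀ (s : R.Face) : s.1 = ∅ := Set.eq_empty_of_isEmpty _
    refine ⟨⟨fun a b => ?_⟩, ⟨R.dual.component _ ⟨∅, Or.inr ⟨hE, rfl⟩⟩⟩⟩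
    obtain ⟨s, rfl⟩ := R.dual.component_surjective _ a
    obtain ⟨t, rfl⟩ := R.dual.component_surjective _ b
    rw [Subtype.ext ((h₀ s).trans (h₀ t).symm)]
  · refine ⟨⟨fun a b => ?_⟩, ⟨R.dual.component _ (R.left hE.some)⟩⟩
    obtain ⟨s, rfl⟩ := R.dual.component_surjective _ a
    obtain ⟨t, rfl⟩ := R.dual.component_surjective _ b
    obtain ⟨e, rfl⟩ := R.left_surjective s
    obtain ⟨e', rfl⟩ := R.left_surjective t
    -- The edges issued from `v` and `w` lie on faces of the same component.
    let r (v w : V) : Prop := v = w ∨ (∃ e, G.src e = v) ∧ (∃ e, G.src e = w) ∧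
      ∀ e e', G.src e = v → G.src e' = w →
        R.dual.component Finset.univ (R.left e) = R.dual.component Finset.univ (R.left e')
    -- Demanding an edge at both vertices keeps the last condition from being vacuous, which would
    -- break transitivity.
    have hr : Equivalence r := by
      refine ⟨fun _ => Or.inl rfl, ?_, ?_⟩
      · rintro v w (rfl | ⟨h₁, h₂, h⟩)
        · exact Or.inl rfl
        · exact Or.inr ⟨h₂, h₁, fun e e' he he' => (h e' e he' he).symm⟩
      · rintro u v w (rfl | ⟨h₁, h₂, h⟩) (rfl | ⟨h₁', h₂', h'⟩)
        · exact Or.inl rfl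
        · exact Or.inr ⟨h₁', h₂', h'⟩
        · exact Or.inr ⟨h₁, h₂, h⟩
        · obtain ⟨f, hf⟩ := h₂
          exact Or.inr ⟨h₁, h₂', fun e e' he he' => (h e f he hf).trans (h' f e' hf he')⟩
    have key : r (G.src e) (G.src e') := by
      refine component_induction hr (fun f _ => Or.inr ⟨⟨f, rfl⟩, ⟨_, G.src_inv f⟩, ?_⟩)
        (hG.component_eq _ _)
      intro e e' he he'
      rw [R.component_left_of_src_eq he, ← R.component_left_inv f]
      exact R.component_left_of_src_eq ((G.src_inv f).trans he'.symm)
    rcases key with h | ⟨-, -, h⟩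
    · exact R.component_left_of_src_eq h
    · exact h e e' rfl rfl

end Connectedness

/-! ### Cycles of the dual graph and cuts -/

/-- The map `C₁(G†, ℤ) → C¹(G, ℤ)`, `e† ↦ e⋆`, transposed of `♯`. -/
def dualSharp : R.dual.Chain1 →ₗ[ℤ] G.Cochain1 :=
  R.dual.liftChain G.star G.star_inv

theorem dual_star_edge (e f : E) : R.dual.star e (R.dual.edge f) = G.star e (G.edge f) := by
  classical
  rw [star_edge, star_edge]
  rfl

theorem dualSharp_edge (e : E) : R.dualSharp (R.dual.edge e) = G.star e :=
  R.dual.liftChain_edge _ _ e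

theorem sharp_edge (e : E) : R.sharp (G.edge e) = R.dual.star e :=
  G.liftChain_edge _ _ e

/-- The transposition rests on the symmetry of `e⋆(f)` in `e` and `f`. -/
theorem sharp_apply_apply (c : G.Chain1) (x : R.dual.Chain1) :
    R.sharp c x = R.dualSharp x c := by
  have h : R.sharp = R.dualSharp.flip := by
    refine chain_hom_ext fun e => chain_hom_ext fun f => ?_
    rw [LinearMap.flip_apply, dualSharp_edge, sharp_edge, dual_star_edge,
      star_edge_comm]
  rw [h, LinearMap.flip_apply]

theorem dualSharp_apply_edge (x : R.dual.Chain1) (e : E) :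
    R.dualSharp x (G.edge e) = R.dual.star e x := by
  rw [← sharp_apply_apply, sharp_edge]

section Duality

variable {P : Finset E}

theorem isOrientation_dual (hP : G.IsOrientation P) : R.dual.IsOrientation P :=
  hP

theorem dualSharp_injective (hP : G.IsOrientation P) : Function.Injective R.dualSharp := by
  rw [injective_iff_map_eq_zero]
  intro x hx
  rw [← (R.isOrientation_dual hP).sum_star_smul_edge x]
  refine Finset.sum_eq_zero fun e _ => ?_
  rw [← dualSharp_apply_edge, hx, LinearMap.zero_apply, zero_smul]

variable [Fintype E]

/-- The candidate cycle has the values of `δf` as coefficients. Its boundary at a face is the sum of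
the increments of `f` around that face, which telescopes. -/
theorem cuts_le_map_cycles_dual (hP : G.IsOrientation P) :
    G.cuts ∅ ≤ (R.dual.cycles Finset.univ).map R.dualSharp := by
  rintro _ ⟨f, -, rfl⟩
  set c := G.coboundary f with hc
  refine ⟨∑ e ∈ P, c (G.edge e) • R.dual.edge e, ⟨Submodule.sum_mem _ fun e _ =>
    Submodule.smul_mem _ _ (Submodule.subset_span ⟨e, by simp, rfl⟩), LinearMap.mem_ker.2 ?_⟩, ?_⟩
  · let s (e : E) : R.Face →₀ ℤ := Finsupp.single (R.left e) 1
    calc R.dual.boundary (∑ e ∈ P, c (G.edge e) • R.dual.edge e)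
        = ∑ e ∈ P, (c (G.edge e) • s e + c (G.edge (G.inv e)) • s (G.inv e)) := by
          rw [map_sum]
          refine Finset.sum_congr rfl fun e _ => ?_
          rw [map_smul, boundary_edge, edge_inv, map_neg, neg_smul, ← sub_eq_add_neg, ← smul_sub]
          rfl
      -- The face on the right of `e` is on the left of `e⁻¹`, so the sum runs over all oriented
      -- edges.
      _ = ∑ e, c (G.edge e) • s e := (hP.sum_univ _).symm
      -- The next edge along the face starts at the end of `e` and has the same face on its left.
      _ = ∑ e, f (Finsupp.single (G.src (R.facePerm e)) 1) • s (R.facePerm e) -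
            ∑ e, f (Finsupp.single (G.src e) 1) • s e := by
          rw [← Finset.sum_sub_distrib]
          refine Finset.sum_congr rfl fun e _ => ?_
          simp only [s]
          rw [hc, coboundary_apply_edge, src_facePerm, left_facePerm, sub_smul]
      _ = 0 := by
          rw [Equiv.sum_comp R.facePerm fun e => f (Finsupp.single (G.src e) 1) • s e, sub_self]
  · refine chain_hom_ext fun e => ?_
    rw [dualSharp_apply_edge, map_sum]
    conv_rhs => rw [← hP.sum_star_smul_edge (G.edge e), map_sum]
    refine Finset.sum_congr rfl fun e' _ => ?_
    rw [map_smul, map_smul, dual_star_edge, star_edge_comm, smul_eq_mul, smul_eq_mul, mul_comm]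

variable [Finite V]

/-- On the sphere, closed cochains are exact: `Z₁(G†, ℤ)` is identified with `B¹(G, ℤ)`. -/
theorem map_cycles_dual_univ (hG : G.Connected) (hR : R.IsSpherical) (hP : G.IsOrientation P) :
    (R.dual.cycles Finset.univ).map R.dualSharp = G.cuts ∅ := by
  classical
  refine le_antisymm (fun c hc => ?_) (R.cuts_le_map_cycles_dual hP)
  set M := (R.dual.cycles Finset.univ).map R.dualSharp
  set N := (G.cuts ∅).comap M.subtype
  have hM : Module.finrank ℤ M + Nat.card R.Face = P.card + 1 := by
    have h₁ := (R.isOrientation_dual hP).finrank_cycles R.dual.isSpanningSubgraph_univ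
    have h₂ : R.dual.numComponents Finset.univ = 1 := R.dual_connected hG
    rwa [h₂, Finset.inter_univ,
      (Submodule.equivMapOfInjective _ (R.dualSharp_injective hP) _).finrank_eq] at h₁
  have hN : Module.finrank ℤ N + 1 = Nat.card V := by
    have h₁ := G.finrank_cuts ∅
    have h₂ : G.numComponents Finset.univ = 1 := hG
    rwa [h₂, numComponents_empty,
      ← (Submodule.comapSubtypeEquivOfLe (R.cuts_le_map_cycles_dual hP)).finrank_eq] at h₁
  -- This makes the integer division by 2 in `IsSpherical` exact.
  have hE := hP.card_eq_two_mul
  have hq := N.finrank_quotient_add_finrank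
  have h₀ : Module.finrank ℤ (M ⧸ N) = 0 := by
    unfold IsSpherical at hR
    omega
  -- A quotient of rank zero is torsion, and saturation of the cuts leaves no torsion.
  obtain ⟨n, hn, h⟩ := Module.finrank_eq_zero_iff.1 h₀ (Submodule.Quotient.mk ⟨c, hc⟩)
  rw [← Submodule.Quotient.mk_smul, Submodule.Quotient.mk_eq_zero] at h
  exact hG.mem_cuts_of_smul_mem hn h

/-- Duality between the cycles of a subgraph of `G†` and the cuts of a quotient of `G`. -/
theorem map_cycles_dual_compl [DecidableEq E] (hG : G.Connected) (hR : R.IsSpherical)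
    (hP : G.IsOrientation P) {S : Finset E} (hS : G.IsSpanningSubgraph S) :
    (R.dual.cycles Sᶜ).map R.dualSharp = G.cuts S := by
  have hS' : R.dual.IsSpanningSubgraph Sᶜ := hS.compl
  have hP' := R.isOrientation_dual hP
  ext c
  rw [mem_cuts_iff, ← R.map_cycles_dual_univ hG hR hP]
  constructor
  · rintro ⟨x, ⟨hx, hx'⟩, rfl⟩
    refine ⟨⟨x, ⟨?_, hx'⟩, rfl⟩, fun e he => ?_⟩
    · exact Submodule.span_mono (Set.image_mono (by simp)) hx
    · rw [dualSharp_apply_edge]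
      exact (hP'.mem_chainsOn_iff hS').1 hx e (by simpa using he)
  · rintro ⟨⟨x, ⟨-, hx'⟩, rfl⟩, h⟩
    refine ⟨x, ⟨(hP'.mem_chainsOn_iff hS').2 fun e he => ?_, hx'⟩, rfl⟩
    rw [← dualSharp_apply_edge]
    exact h e (by simpa using he)

/-- The isomorphism between `Z₁(Sᶜ, ℤ)` in the dual graph and `B¹(G/S, ℤ)`. -/
def cyclesEquivCuts [DecidableEq E] (hG : G.Connected) (hR : R.IsSpherical)
    (hP : G.IsOrientation P) {S : Finset E} (hS : G.IsSpanningSubgraph S) :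
    R.dual.cycles Sᶜ ≃ₗ[ℤ] G.cuts S :=
  (Submodule.equivMapOfInjective _ (R.dualSharp_injective hP) _).trans
    (LinearEquiv.ofEq _ _ (R.map_cycles_dual_compl hG hR hP hS))

/-- Write `c` for numbers of components and `β` for ranks of cycle groups, with a dagger in `G†`.
The isomorphism with the cuts gives `β†(Sᶜ) = c(S) - 1`; the two rank formulas and Euler's formula
then give `c†(Sᶜ) = β(S) + 1`. The two pairs of conditions are thus exchanged. -/
theorem mem_connectedSubgraphs_compl_iff [DecidableEq E] (hG : G.Connected) (hR : R.IsSpherical)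
    (hP : G.IsOrientation P) (k : ℕ) (S : Finset E) :
    Sᶜ ∈ R.dual.connectedSubgraphs k ↔ S ∈ G.forests (k + 1) := by
  simp only [connectedSubgraphs, forests, Finset.mem_filter, Finset.mem_univ, true_and]
  have hiff : R.dual.IsSpanningSubgraph Sᶜ ↔ G.IsSpanningSubgraph S :=
    ⟨fun h => compl_compl S ▸ IsSpanningSubgraph.compl (G := G) h,
      fun h => IsSpanningSubgraph.compl (G := G) h⟩
  rw [hiff]
  refine and_congr_right fun hS => ?_
  have h₁ := (R.cyclesEquivCuts hG hR hP hS).finrank_eq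
  have h₂ := G.finrank_cuts S
  have h₃ : G.numComponents Finset.univ = 1 := hG
  have h₄ := hP.finrank_cycles hS
  have h₅ := (R.isOrientation_dual hP).finrank_cycles (hiff.2 hS)
  have h₆ : (P ∩ S).card + (P ∩ Sᶜ).card = P.card := by
    rw [← Finset.sdiff_eq_inter_compl, Finset.card_inter_add_card_sdiff]
  have h₇ := hP.card_eq_two_mul
  unfold IsSpherical at hR
  have := hP.isTorsionFree
  -- Without torsion, having no non-zero cycle means having rank zero.
  rw [← Submodule.finrank_eq_zero (R := ℤ)]
  omega

end Duality

/-! ### Weights -/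

variable {𝕜 : Type*} [RCLike 𝕜] {k : ℕ}

theorem formToDual_dualSharp (x : R.dual.Chain1) (φ : G.KChain1 𝕜) :
    G.formToDual (1 ⊗ₜ[ℤ] R.dualSharp x) φ =
      R.dual.formToDual (R.sharp.baseChange 𝕜 φ) (1 ⊗ₜ[ℤ] x) := by
  induction φ using TensorProduct.induction_on with
  | zero => simp
  | add φ ψ h₁ h₂ => rw [map_add, h₁, h₂, map_add, map_add, LinearMap.add_apply]
  | tmul a c => simp [formToDual, sharp_apply_apply, mul_comm]

theorem pairing_wedge_dualSharp (x : Fin k → R.dual.Chain1) (φ : ⋀[𝕜]^k (G.KChain1 𝕜)) :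
    G.pairing k (wedge 𝕜 fun i => R.dualSharp (x i)) φ =
      R.dual.pairing k (R.sharpPow 𝕜 k φ) (wedge 𝕜 x) := by
  have h : exteriorPower.pairingDual 𝕜 (G.KChain1 𝕜) k
        (exteriorPower.map k G.formToDual (wedge 𝕜 fun i => R.dualSharp (x i))) =
      (exteriorPower.pairingDual 𝕜 (R.dual.KChain1 𝕜) k ∘ₗ
        exteriorPower.map k R.dual.formToDual ∘ₗ R.sharpPow 𝕜 k).flip (wedge 𝕜 x) := by
    refine exteriorPower.linearMap_ext (AlternatingMap.ext fun φ => ?_)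
    simp only [LinearMap.compAlternatingMap_apply, LinearMap.flip_apply, LinearMap.comp_apply,
      wedge, sharpPow, exteriorPower.map_apply_ιMulti, exteriorPower.pairingDual_ιMulti_ιMulti]
    -- The `x i` give the forms on one side and the vectors on the other, so the two matrices are
    -- transposed.
    rw [← Matrix.det_transpose]
    congr 1
    ext i j
    exact R.formToDual_dualSharp (x i) (φ j)
  exact LinearMap.congr_fun h φ

theorem cycleWeight_sharpPow [Fintype E] [Finite V] [DecidableEq E] (hG : G.Connected)
    (hR : R.IsSpherical) {P : Finset E} (hP : G.IsOrientation P) {S : Finset E}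
    (hS : G.IsSpanningSubgraph S) (φ : ⋀[𝕜]^k (G.KChain1 𝕜)) :
    R.dual.cycleWeight k (R.sharpPow 𝕜 k φ) Sᶜ = G.cutWeight k φ S := by
  let D := R.cyclesEquivCuts hG hR hP hS
  by_cases h : Nonempty (Module.Basis (Fin k) ℤ (R.dual.cycles Sᶜ))
  · obtain ⟨b⟩ := h
    rw [cycleWeight_eq _ _ _ _ b, cutWeight_eq _ _ _ _ (b.map D), ← pairing_wedge_dualSharp]
    rfl
  -- If the rank is not `k`, both weights take the default value `0`.
  · have h' : ¬Nonempty (Module.Basis (Fin k) ℤ (G.cuts S)) := fun ⟨b⟩ => h ⟨b.map D.symm⟩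
    rw [cycleWeight, cutWeight, dif_neg h, dif_neg h']

end RotationSystem

/-! ### Polynomials -/

/-- Each variable outside `S` cancels against its inverse, and those in `S` remain. -/
theorem prod_X_mul_aeval_inv_monomial {E : Type*} [Fintype E] [DecidableEq E] {P : Finset E}
    {K : Type*} [Field K] [Algebra ℝ K] [Algebra (MvPolynomial {e // e ∈ P} ℝ) K]
    [IsFractionRing (MvPolynomial {e // e ∈ P} ℝ) K] (S : Finset E) :
    (∏ e : {e // e ∈ P}, algebraMap (MvPolynomial {e // e ∈ P} ℝ) K (MvPolynomial.X e)) *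
        MvPolynomial.aeval (fun e : {e // e ∈ P} =>
          (algebraMap (MvPolynomial {e // e ∈ P} ℝ) K (MvPolynomial.X e))⁻¹) (monomial P Sᶜ) =
      algebraMap (MvPolynomial {e // e ∈ P} ℝ) K (monomial P S) := by
  rw [monomial, monomial, map_prod, map_prod, Finset.prod_filter, Finset.prod_filter,
    ← Finset.prod_mul_distrib]
  refine Finset.prod_congr rfl fun e _ => ?_
  have hX : algebraMap (MvPolynomial {e // e ∈ P} ℝ) K (MvPolynomial.X e) ≠ 0 := by
    simp
  by_cases he : e.1 ∈ S
  · simp [he]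
  · simp [he, hX]

end OrientedGraph

end

/-! ### The duality theorem -/

theorem mainTheorem11 {𝕜 : Type*} [RCLike 𝕜] {V E : Type*} [Finite V] [Fintype E] [DecidableEq E]
    (G : OrientedGraph V E) (hG : G.Connected) (R : G.RotationSystem) (hR : R.IsSpherical)
    (P : Finset E) (hP : G.IsOrientation P) (k : ℕ) :
    Set.BijOn (fun F : Finset E => Fᶜ) (G.forests (k + 1)) (R.dual.connectedSubgraphs k) ∧
    ∀ φ : ⋀[𝕜]^k (G.KChain1 𝕜),
      algebraMap (MvPolynomial {e // e ∈ P} ℝ) (FractionRing (MvPolynomial {e // e ∈ P} ℝ))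
          (G.forestPoly P k φ) =
        (∏ e : {e // e ∈ P}, algebraMap (MvPolynomial {e // e ∈ P} ℝ)
            (FractionRing (MvPolynomial {e // e ∈ P} ℝ)) (MvPolynomial.X e)) *
          MvPolynomial.aeval
            (fun e : {e // e ∈ P} => (algebraMap (MvPolynomial {e // e ∈ P} ℝ)
              (FractionRing (MvPolynomial {e // e ∈ P} ℝ)) (MvPolynomial.X e))⁻¹)
            (R.dual.connectedPoly P k (R.sharpPow 𝕜 k φ)) := by
  have hmem := R.mem_connectedSubgraphs_compl_iff hG hR hP k
  -- Dual edges keep their labels, so `(Fᶜ)†` is the complement of `F` as a set of labels.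
  have hbij : Set.BijOn (fun F : Finset E => Fᶜ) (G.forests (k + 1))
      (R.dual.connectedSubgraphs k) :=
    ⟨fun S hS => (hmem S).2 hS, compl_injective.injOn, fun S hS =>
      ⟨Sᶜ, (hmem Sᶜ).1 (by rwa [compl_compl]), compl_compl S⟩⟩
  refine ⟨hbij, fun φ => ?_⟩
  rw [OrientedGraph.forestPoly, OrientedGraph.connectedPoly, map_sum, map_sum, Finset.mul_sum]
  refine Finset.sum_bij (fun F _ => Fᶜ) (fun F hF => hbij.mapsTo hF)
    (fun F _ F' _ h => compl_injective h) (fun K hK => ?_) fun F hF => ?_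
  · obtain ⟨F, hF, h⟩ := hbij.surjOn hK
    exact ⟨F, hF, h⟩
  · have hS : G.IsSpanningSubgraph F := by
      simp only [OrientedGraph.forests, Finset.mem_filter] at hF
      exact hF.2.1
    rw [R.cycleWeight_sharpPow hG hR hP hS, Algebra.smul_def, map_mul,
      ← IsScalarTower.algebraMap_apply, ← Algebra.smul_def, map_smul, mul_smul_comm,
      OrientedGraph.prod_X_mul_aeval_inv_monomial]
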